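/- Let $d\ge 2$ and let $\Omega\subset\mathbb{R}^d$ be a bounded convex open set with $C^2$ boundary: near each $x\in\partial\Omega$, $\Omega=\{\xi<0\}$ for a $C^2$ function $\xi$ with $\nabla\xi(x)\ne 0$, and $n(x)=\nabla\xi(x)/|\nabla\xi(x)|$ is the outward unit normal. Let $\Lambda_0=\{(x,v)\in\partial\Omega\times\mathbb{R}^d:\ n(x)\cdot v=0\}$ and let $T_\partial>0$ be the wall temperature. Collision kernel. Let $B=\Phi(|v-v_*|)\,b(\cos\theta)$ with $\Phi$ measurable and, for some $\gamma\in(-d,1]$ and constants $c_\Phi,C_\Phi>0$, either (a) $c_\Phi z^\gamma\le\Phi(z)\le C_\Phi z^\gamma$ for all $z>0$, or (b) $c_\Phi z^\gamma\le\Phi(z)\le C_\Phi z^\gamma$ for $z\ge1$ and $c_\Phi\le\Phi(z)\le C_\Phi$ for $0\le z\le1$. Let $\theta\mapsto b(\cos\theta)$ be non-negative and continuous on $(0,\pi]$, strictly positive near $\theta=\pi/2$, with $b(\cos\theta)\sin^{d-2}\theta\sim b_0\theta^{-(1+\nu)}$ as $\theta\to0^+$ for some $b_0>0$ and $\nu<0$.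 Put $$Q^+[g,h](v)=\int_{\mathbb{R}^d\times\mathbb{S}^{d-1}}\Phi(|v-v_*|)\,b(\cos\theta)\,h(v')\,g(v'_*)\,dv_*\,d\sigma,\qquad L[g](v)=n_b\int_{\mathbb{R}^d}\Phi(|v-v_*|)\,g(v_*)\,dv_*,$$ where $v'=\frac{v+v_*}2+\frac{|v-v_*|}2\sigma$, $v'_*=\frac{v+v_*}2-\frac{|v-v_*|}2\sigma$, $\cos\theta=\big\langle\frac{v-v_*}{|v-v_*|},\sigma\big\rangle$ and $n_b=|\mathbb{S}^{d-2}|\int_0^\pi b(\cos\theta)\sin^{d-2}\theta\,d\theta$. Mild solutions. Let $T\in(0,+\infty]$, let $X_{s,t}(x,v)=x-(t-s)v$, let $t_\partial(x,v)=\min\{t\ge0:\ x-tv\in\partial\Omega\}$ ($+\infty$ if there is no such $t$), let $x_\partial(x,v)=x-t_\partial(x,v)v$, and $$f_\partial(t,x,v)=\Big[\int_{v_*\cdot n(x)>0}f(t,x,v_*)\,(v_*\cdot n(x))\,dv_*\Big]\frac{1}{(2\pi)^{\frac{d-1}2}T_\partial^{\frac{d+1}2}}\,e^{-\frac{|v|^2}{2T_\partial}}.$$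 Let $f_0\ge0$ be continuous on $\bar\Omega\times\mathbb{R}^d$. A measurable $f\ge0$ on $[0,T)\times\bar\Omega\times\mathbb{R}^d$ is a mild solution with initial datum $f_0$ if for all $(t,x,v)\in[0,T)\times\Omega\times\mathbb{R}^d$ the functions $s\mapsto L[f(s,X_{s,t}(x,v),\cdot)](v)$ and $s\mapsto Q^+[f(s,X_{s,t}(x,v),\cdot),f(s,X_{s,t}(x,v),\cdot)](v)$, considered for those $s\in[0,T)$ with $X_{s,t}(x,v)\in\bar\Omega$, are integrable on $[0,T']$ for every $T'<T$, and, writing $X_s=X_{s,t}(x,v)$, $$f(t,x,v)=A\,e^{-\int_a^tL[f(s,X_s,\cdot)](v)\,ds}+\int_a^te^{-\int_s^tL[f(s',X_{s'},\cdot)](v)\,ds'}\,Q^+[f(s,X_s,\cdot),f(s,X_s,\cdot)](v)\,ds,$$ where $a=0$ and $A=f_0(x-tv,v)$ if $t\le t_\partial(x,v)$, and $a=t-t_\partial(x,v)$ and $A=f_\partial\big(t-t_\partial(x,v),x_\partial(x,v),v\big)$ if $t>t_\partial(x,v)$ (all terms being finite). Let $f$ be a mild solution with initial datum $f_0$ such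 that - $f$ is continuous on $[0,T)\times\big((\bar\Omega\times\mathbb{R}^d)\setminus\Lambda_0\big)$, $f(0,\cdot,\cdot)=f_0$ on $\bar\Omega\times\mathbb{R}^d$, and there is $M>0$ with $\int_\Omega\int_{\mathbb{R}^d}f(t,x,v)\,dv\,dx=M$ for all $t\in[0,T)$; - $\sup_{(t,x)\in[0,T)\times\Omega}\int_{\mathbb{R}^d}|v|^2f(t,x,v)\,dv<\infty$; - if (a) holds with $\gamma<0$, then moreover $\sup_{(t,x)\in[0,T)\times\Omega}\|f(t,x,\cdot)\|_{L^p(\mathbb{R}^d)}<\infty$ for some finite $p>d/(d+\gamma)$. Then for every $\Delta\in(0,T)$ and every $\tau_0\in(0,\Delta]$ there exists $b_\partial(\tau_0)>0$ such that $$\forall t\in[\tau_0,\Delta],\ \forall x\in\partial\Omega,\qquad \int_{v\cdot n(x)>0}f(t,x,v)\,(v\cdot n(x))\,dv>b_\partial(\tau_0).$$ -/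

import Mathlib

open MeasureTheory Set Filter Topology
open scoped ENNReal RealInnerProductSpace

noncomputable section

/-- Position and velocity space `ℝ^d` with its Euclidean norm. -/
abbrev Space (d : ℕ) : Type := EuclideanSpace ℝ (Fin d)

/-! ### The domain and its outward normal -/

/-- `ν` is the outward unit normal of `Ω` at the boundary point `x`: near `x` the set `Ω` is
`{ξ < 0}` for a function `ξ` of class `C²` whose gradient at `x` is non-zero and is a positive
multiple of the unit vector `ν`. -/
def IsOutwardNormal {d : ℕ} (Ω : Set (Space d)) (x ν : Space d) : Prop :=
  ‖ν‖ = 1 ∧ ∃ ξ : Space d → ℝ, ContDiffAt ℝ 2 ξ x ∧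
    (∃ c : ℝ, 0 < c ∧ HasGradientAt ξ (c • ν) x) ∧ ∀ᶠ y in 𝓝 x, (y ∈ Ω ↔ ξ y < 0)

/-- Open sets with `C²` boundary and nowhere vanishing normal vector. -/
structure IsC2Domain {d : ℕ} (Ω : Set (Space d)) : Prop where
  isOpen : IsOpen Ω
  exists_normal : ∀ x ∈ frontier Ω, ∃ ν, IsOutwardNormal Ω x ν

/-- The outward unit normal `n(x)` (meaningful for `x ∈ ∂Ω`). -/
def outwardNormal {d : ℕ} (Ω : Set (Space d)) (x : Space d) : Space d :=
  Classical.epsilon (IsOutwardNormal Ω x)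

theorem IsC2Domain.outwardNormal_spec {d : ℕ} {Ω : Set (Space d)} (h : IsC2Domain Ω)
    {x : Space d} (hx : x ∈ frontier Ω) : IsOutwardNormal Ω x (outwardNormal Ω x) :=
  Classical.epsilon_spec (h.exists_normal x hx)

/-- The grazing set `Λ₀ = {(x, v) ∈ ∂Ω × ℝ^d : n(x) · v = 0}`. -/
def grazingSet {d : ℕ} (Ω : Set (Space d)) : Set (Space d × Space d) :=
  {p | p.1 ∈ frontier Ω ∧ ⟪outwardNormal Ω p.1, p.2⟫ = 0}

/-! ### The collision kernel -/

/-- `c |z|^γ ≤ Φ(z) ≤ C |z|^γ` with constants `c, C > 0`; `Φ` is only evaluated at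
`z = |v - v_*| ≥ 0`, and `z = 0` corresponds to a null set. -/
def IsPowerKernel (Φ : ℝ → ℝ) (γ : ℝ) : Prop :=
  ∃ c C : ℝ, 0 < c ∧ 0 < C ∧ ∀ z : ℝ, 0 < z → c * z ^ γ ≤ Φ z ∧ Φ z ≤ C * z ^ γ

/-- The mollified assumption: `c |z|^γ ≤ Φ(z) ≤ C |z|^γ` for `|z| ≥ 1` and `c ≤ Φ(z) ≤ C` for
`|z| ≤ 1`, with constants `c, C > 0`. -/
def IsMollifiedKernel (Φ : ℝ → ℝ) (γ : ℝ) : Prop :=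
  ∃ c C : ℝ, 0 < c ∧ 0 < C ∧
    (∀ z : ℝ, 1 ≤ z → c * z ^ γ ≤ Φ z ∧ Φ z ≤ C * z ^ γ) ∧
    (∀ z : ℝ, 0 ≤ z → z ≤ 1 → c ≤ Φ z ∧ Φ z ≤ C)

/-- The angular kernel: `θ ↦ b(cos θ)` is non-negative and continuous on `(0, π]`, strictly
positive near `θ = π/2`, and `b(cos θ) sin^{d-2} θ ∼ b₀ θ^{-(1+ν)}` as `θ → 0⁺` for some
`b₀ > 0`. -/
structure IsAngularKernel (d : ℕ) (b : ℝ → ℝ) (ν : ℝ) : Prop where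
  nonneg : ∀ θ ∈ Ioc 0 Real.pi, 0 ≤ b (Real.cos θ)
  continuousOn : ContinuousOn (fun θ : ℝ => b (Real.cos θ)) (Ioc 0 Real.pi)
  pos_near : ∀ᶠ θ in 𝓝 (Real.pi / 2), 0 < b (Real.cos θ)
  asymptotics : ∃ b₀ : ℝ, 0 < b₀ ∧
    Asymptotics.IsEquivalent (𝓝[>] (0 : ℝ))
      (fun θ : ℝ => b (Real.cos θ) * Real.sin θ ^ (d - 2)) (fun θ : ℝ => b₀ * θ ^ (-(1 + ν)))

/-! ### Grad's splitting of the collision operator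

All integrands are non-negative on non-negative functions, so the operators take values in
`[0, ∞]`. -/

/-- `n_b = |S^{d-2}| ∫_0^π b(cos θ) sin^{d-2} θ dθ`. -/
def angularMass (d : ℕ) (b : ℝ → ℝ) : ℝ :=
  ((volume : Measure (Space (d - 1))).toSphere univ).toReal *
    ∫ θ in (0 : ℝ)..Real.pi, b (Real.cos θ) * Real.sin θ ^ (d - 2)

/-- `L[g](v) = n_b (Φ * g)(v) = n_b ∫ Φ(|v - v_*|) g(v_*) dv_*`. -/
def lossL {d : ℕ} (Φ b : ℝ → ℝ) (g : Space d → ℝ) (v : Space d) : ℝ≥0∞ :=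
  ENNReal.ofReal (angularMass d b) * ∫⁻ w : Space d, ENNReal.ofReal (Φ ‖v - w‖ * g w)

/-- `v' = (v + v_*)/2 + |v - v_*|/2 σ`. -/
def postVel {d : ℕ} (v w σ : Space d) : Space d :=
  (1 / 2 : ℝ) • (v + w) + (‖v - w‖ / 2) • σ

/-- `v'_* = (v + v_*)/2 - |v - v_*|/2 σ`. -/
def postVelStar {d : ℕ} (v w σ : Space d) : Space d :=
  (1 / 2 : ℝ) • (v + w) - (‖v - w‖ / 2) • σ

/-- `cos θ = ⟨(v - v_*)/|v - v_*|, σ⟩`. -/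
def cosAngle {d : ℕ} (v w σ : Space d) : ℝ := ⟪(‖v - w‖⁻¹ : ℝ) • (v - w), σ⟫

/-- `Q⁺(g, h)(v) = ∫_{ℝ^d × S^{d-1}} Φ(|v - v_*|) b(cos θ) h(v') g(v'_*) dv_* dσ`, where `dσ` is
the surface measure of the unit sphere. -/
def gainQ {d : ℕ} (Φ b : ℝ → ℝ) (g h : Space d → ℝ) (v : Space d) : ℝ≥0∞ :=
  ∫⁻ p : Space d × Metric.sphere (0 : Space d) 1,
    ENNReal.ofReal (Φ ‖v - p.1‖ * b (cosAngle v p.1 p.2) *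
      h (postVel v p.1 p.2) * g (postVelStar v p.1 p.2))
    ∂((volume : Measure (Space d)).prod (volume : Measure (Space d)).toSphere)

/-! ### Characteristics and the diffusive wall -/

/-- The time interval `[0, T)`, where `T ∈ (0, ∞]`. -/
def timeInterval (T : EReal) : Set ℝ := {t | 0 ≤ t ∧ (t : EReal) < T}

/-- `X_{s,t}(x, v) = x - (t - s) v`. -/
def charX {d : ℕ} (s t : ℝ) (x v : Space d) : Space d := x - (t - s) • v

/-- `t_∂(x, v) = min {t ≥ 0 : x - t v ∈ ∂Ω}`, with value `∞` if the backward trajectory never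
meets the boundary. -/
def exitTime {d : ℕ} (Ω : Set (Space d)) (x v : Space d) : ℝ≥0∞ :=
  ⨅ t ∈ {t : ℝ | 0 ≤ t ∧ x - t • v ∈ frontier Ω}, ENNReal.ofReal t

/-- The outgoing flux `∫_{v · n(x) > 0} g(v) (v · n(x)) dv` of a non-negative `g`. -/
def outgoingFlux {d : ℕ} (Ω : Set (Space d)) (g : Space d → ℝ) (x : Space d) : ℝ≥0∞ :=
  ∫⁻ v in {v : Space d | 0 < ⟪v, outwardNormal Ω x⟫},
    ENNReal.ofReal (g v * ⟪v, outwardNormal Ω x⟫)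

/-- The wall Maxwellian `(2π)^{-(d-1)/2} T_∂^{-(d+1)/2} exp(-|v|²/(2 T_∂))`. -/
def wallMaxwellian {d : ℕ} (Tw : ℝ) (v : Space d) : ℝ :=
  1 / ((2 * Real.pi) ^ (((d : ℝ) - 1) / 2) * Tw ^ (((d : ℝ) + 1) / 2)) *
    Real.exp (-(‖v‖ ^ 2 / (2 * Tw)))

/-- `f_∂(t, x, v)`, the distribution emitted by the wall. -/
def wallEmission {d : ℕ} (Ω : Set (Space d)) (Tw : ℝ) (f : ℝ → Space d → Space d → ℝ)
    (t : ℝ) (x v : Space d) : ℝ≥0∞ :=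
  outgoingFlux Ω (f t x) x * ENNReal.ofReal (wallMaxwellian Tw v)

/-! ### Mild solutions -/

/-- `exp(-∫_s^t L[f(s', X_{s',t}(x, v), ·)](v) ds')`. -/
def damping {d : ℕ} (Φ b : ℝ → ℝ) (f : ℝ → Space d → Space d → ℝ)
    (s t : ℝ) (x v : Space d) : ℝ≥0∞ :=
  ENNReal.ofReal (Real.exp (-∫ u in s..t, (lossL Φ b (f u (charX u t x v)) v).toReal))

/-- `∫_a^t exp(-∫_s^t L[f(s', X_{s',t}, ·)](v) ds') Q⁺[f(s, X_{s,t}, ·), f(s, X_{s,t}, ·)](v) ds`,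
where `X_{s,t} = X_{s,t}(x, v)`. -/
def duhamelGain {d : ℕ} (Φ b : ℝ → ℝ) (f : ℝ → Space d → Space d → ℝ)
    (a t : ℝ) (x v : Space d) : ℝ≥0∞ :=
  ∫⁻ s in Ioc a t, damping Φ b f s t x v *
    gainQ Φ b (f s (charX s t x v)) (f s (charX s t x v)) v

/-- The times `s ∈ [0, T']` at which the characteristic through `(t, x, v)` lies in the closure
of `Ω`. -/
def insideTimes {d : ℕ} (Ω : Set (Space d)) (T' t : ℝ) (x v : Space d) : Set ℝ :=
  {s | s ∈ Icc 0 T' ∧ charX s t x v ∈ closure Ω}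

/-- Membership in `L¹_loc([0, T))` along the characteristic through `(t, x, v)`, for a
`[0, ∞]`-valued function `F` of time that is defined as long as the characteristic lies in the
closure of `Ω`. -/
def LocallyIntegrableAlong {d : ℕ} (Ω : Set (Space d)) (T : EReal) (t : ℝ) (x v : Space d)
    (F : ℝ → ℝ≥0∞) : Prop :=
  ∀ T' ∈ timeInterval T,
    AEMeasurable F (volume.restrict (insideTimes Ω T' t x v)) ∧
      ∫⁻ s in insideTimes Ω T' t x v, F s < ∞

/-- Mild solutions on `[0, T)` of the Boltzmann equation with cutoff kernel `Φ b` and diffusive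
boundary condition at wall temperature `Tw`, with initial datum `f₀`. The Duhamel formulas are
identities in `[0, ∞]` between non-negative quantities; as the left-hand sides are finite, so
are all the terms. -/
structure IsMildSolution {d : ℕ} (Ω : Set (Space d)) (Φ b : ℝ → ℝ) (Tw : ℝ) (T : EReal)
    (f₀ : Space d → Space d → ℝ) (f : ℝ → Space d → Space d → ℝ) : Prop where
  aemeasurable : AEMeasurable (fun p : ℝ × Space d × Space d => f p.1 p.2.1 p.2.2)
    (volume.restrict (timeInterval T ×ˢ closure Ω ×ˢ (univ : Set (Space d))))
  nonneg : ∀ t ∈ timeInterval T, ∀ x ∈ closure Ω, ∀ v, 0 ≤ f t x v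
  loss_locallyIntegrable : ∀ t ∈ timeInterval T, ∀ x ∈ Ω, ∀ v,
    LocallyIntegrableAlong Ω T t x v (fun s => lossL Φ b (f s (charX s t x v)) v)
  gain_locallyIntegrable : ∀ t ∈ timeInterval T, ∀ x ∈ Ω, ∀ v,
    LocallyIntegrableAlong Ω T t x v
      (fun s => gainQ Φ b (f s (charX s t x v)) (f s (charX s t x v)) v)
  duhamel_initial : ∀ t ∈ timeInterval T, ∀ x ∈ Ω, ∀ v,
    ENNReal.ofReal t ≤ exitTime Ω x v →
      ENNReal.ofReal (f t x v) =
        ENNReal.ofReal (f₀ (x - t • v) v) * damping Φ b f 0 t x v + duhamelGain Φ b f 0 t x v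
  duhamel_wall : ∀ t ∈ timeInterval T, ∀ x ∈ Ω, ∀ v,
    exitTime Ω x v < ENNReal.ofReal t →
      ENNReal.ofReal (f t x v) =
        wallEmission Ω Tw f (t - (exitTime Ω x v).toReal) (x - (exitTime Ω x v).toReal • v) v *
            damping Φ b f (t - (exitTime Ω x v).toReal) t x v +
          duhamelGain Φ b f (t - (exitTime Ω x v).toReal) t x v

/-! ### Hydrodynamical bounds -/

/-- `E_f = sup_{(t,x) ∈ [0,T) × Ω} ∫ |v|² f(t, x, v) dv`. -/
def energySup {d : ℕ} (Ω : Set (Space d)) (T : EReal) (f : ℝ → Space d → Space d → ℝ) : ℝ≥0∞ :=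
  ⨆ t ∈ timeInterval T, ⨆ x ∈ Ω, ∫⁻ v, ENNReal.ofReal (‖v‖ ^ 2 * f t x v)

/-- `L^p_f = sup_{(t,x) ∈ [0,T) × Ω} ‖f(t, x, ·)‖_{L^p}`. -/
def lpSup {d : ℕ} (Ω : Set (Space d)) (T : EReal) (p : ℝ) (f : ℝ → Space d → Space d → ℝ) :
    ℝ≥0∞ :=
  ⨆ t ∈ timeInterval T, ⨆ x ∈ Ω, eLpNorm (f t x) (ENNReal.ofReal p) volume

/-- The total mass `∫_Ω ∫ f(t, x, v) dv dx` of `g = f(t, ·, ·)`. -/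
def totalMass {d : ℕ} (Ω : Set (Space d)) (g : Space d → Space d → ℝ) : ℝ≥0∞ :=
  ∫⁻ x in Ω, ∫⁻ v, ENNReal.ofReal (g x v)

end

/-! The argument is qualitative: strict positivity is proved pointwise and made uniform by
compactness, so the constant is not explicit.

Since the mass is positive and `f` is continuous, `f` is positive for short times near some interior
point `(x₀, v₀)`. Collisions spread this positivity in velocity. For `v` with `‖v - v₀‖ < √2 R`, the
collision of `v` with `v₀` at angle `π / 2` has both output velocities at distance `‖v - v₀‖ / √2 <
R` from `v₀`, so the gain term is positive at `v` (`gainQ_self_pos_of_ball`). The Duhamel formula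
turns a positive gain along a trajectory inside `Ω` into positivity of `f` at its end, because the
damping is bounded below and the remaining terms are non-negative (`pos_of_gain`). Iterating,
velocities in any prescribed ball around `v₀` are reached, at the cost of a shorter time and a
smaller neighbourhood of `x₀`.

By convexity, any `y` near `x₀` is joined to any boundary point `x` by a segment inside `Ω` up to
`x`. Travelled from a small time `σ` to `t ≥ τ₀`, it has bounded velocity, so `f` is positive at its
end (`pos_on_frontier`). These arrivals are uniformly transverse to the wall
(`le_inner_outwardNormal`), so they avoid the grazing set. Compactness in `(t, x, y)` bounds `f`
below, and integration over a velocity ball of fixed radius bounds the flux. -/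

/-! ### Positivity of the gain operator -/

theorem exists_unit_orthogonal {d : ℕ} (hd : 2 ≤ d) (u : Space d) :
    ∃ σ : Space d, ‖σ‖ = 1 ∧ ⟪u, σ⟫ = 0 := by
  have h1 := Submodule.finrank_add_finrank_orthogonal (ℝ ∙ u)
  have h2 : Module.finrank ℝ (ℝ ∙ u) ≤ 1 := by
    simpa using finrank_span_le_card (R := ℝ) ({u} : Set (Space d))
  rw [finrank_euclideanSpace_fin] at h1
  have h3 : (ℝ ∙ u)ᗮ ≠ ⊥ := by
    intro h
    rw [h, finrank_bot] at h1
    omega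
  obtain ⟨w, hw, hw0⟩ := Submodule.exists_mem_ne_zero_of_ne_bot h3
  refine ⟨(‖w‖⁻¹ : ℝ) • w, norm_smul_inv_norm hw0, ?_⟩
  rw [inner_smul_right, Submodule.mem_orthogonal_singleton_iff_inner_right.1 hw, mul_zero]

theorem kernel_eventually_ge {Φ : ℝ → ℝ} {γ : ℝ} (hΦ : IsPowerKernel Φ γ ∨ IsMollifiedKernel Φ γ)
    {z₀ : ℝ} (hz₀ : 0 < z₀) : ∃ c : ℝ, 0 < c ∧ ∀ᶠ z in 𝓝 z₀, c ≤ Φ z := by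
  have key : ∀ c : ℝ, 0 < c → ∃ m : ℝ, 0 < m ∧ ∀ᶠ z in 𝓝 z₀, m ≤ c * z ^ γ := by
    intro c hc
    have hp : 0 < c * z₀ ^ γ := mul_pos hc (Real.rpow_pos_of_pos hz₀ _)
    refine ⟨c * z₀ ^ γ / 2, half_pos hp, ?_⟩
    have hcont : ContinuousAt (fun z : ℝ => c * z ^ γ) z₀ :=
      continuousAt_const.mul (Real.continuousAt_rpow_const _ _ (Or.inl hz₀.ne'))
    exact (hcont.eventually (lt_mem_nhds (half_lt_self hp))).mono fun _ h => h.le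
  have hev : ∀ᶠ z in 𝓝 z₀, 0 < z := lt_mem_nhds hz₀
  rcases hΦ with ⟨c, C, hc, -, h⟩ | ⟨c, C, hc, -, h, h'⟩
  · obtain ⟨m, hm, hm'⟩ := key c hc
    refine ⟨m, hm, ?_⟩
    filter_upwards [hm', hev] with z h1 h2
    exact h1.trans (h z h2).1
  · obtain ⟨m, hm, hm'⟩ := key c hc
    refine ⟨min m c, lt_min hm hc, ?_⟩
    filter_upwards [hm', hev] with z h1 h2
    rcases le_total 1 z with hz | hz
    · exact (min_le_left _ _).trans (h1.trans (h z hz).1)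
    · exact (min_le_right _ _).trans (h' z h2.le hz).1

/-- The hypotheses concern `θ ↦ b (cos θ)`; composing with the continuous `arccos` turns continuity
at `π / 2` into a bound on `b` itself near `0`. -/
theorem IsAngularKernel.eventually_ge {d : ℕ} {b : ℝ → ℝ} {ν : ℝ} (hb : IsAngularKernel d b ν) :
    ∃ c : ℝ, 0 < c ∧ ∀ᶠ x in 𝓝 (0 : ℝ), c ≤ b x := by
  have hpi := Real.pi_pos
  have hcont : ContinuousAt (fun θ : ℝ => b (Real.cos θ)) (Real.pi / 2) :=
    hb.continuousOn.continuousAt (Ioc_mem_nhds (by linarith) (by linarith))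
  have hpos : 0 < b (Real.cos (Real.pi / 2)) := hb.pos_near.self_of_nhds
  refine ⟨b (Real.cos (Real.pi / 2)) / 2, half_pos hpos, ?_⟩
  have h1 : ∀ᶠ θ in 𝓝 (Real.pi / 2), b (Real.cos (Real.pi / 2)) / 2 < b (Real.cos θ) :=
    hcont.eventually (lt_mem_nhds (half_lt_self hpos))
  have h2 : Tendsto Real.arccos (𝓝 0) (𝓝 (Real.pi / 2)) := by
    simpa using Real.continuous_arccos.tendsto 0
  filter_upwards [h2.eventually h1, Icc_mem_nhds (by norm_num : (-1 : ℝ) < 0) one_pos] with x hx hx1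
  rw [Real.cos_arccos hx1.1 hx1.2] at hx
  exact hx.le

/-- The gain operator is positive at `v` as soon as `g` is positive at the post-collisional
velocities of some non-degenerate collision of `v` with deviation angle `π / 2`. -/
theorem gainQ_self_pos {d : ℕ} {Φ b : ℝ → ℝ} {γ ν : ℝ}
    (hΦ : IsPowerKernel Φ γ ∨ IsMollifiedKernel Φ γ) (hb : IsAngularKernel d b ν)
    {g : Space d → ℝ} (hg : Continuous g) {v w σ : Space d} (hvw : v ≠ w) (hσ : ‖σ‖ = 1)
    (horth : ⟪v - w, σ⟫ = 0) (h1 : 0 < g (postVel v w σ)) (h2 : 0 < g (postVelStar v w σ)) :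
    0 < gainQ Φ b g g v := by
  obtain ⟨cΦ, hcΦ, hΦ'⟩ := kernel_eventually_ge hΦ (norm_pos_iff.2 (sub_ne_zero.2 hvw))
  obtain ⟨cb, hcb, hb'⟩ := hb.eventually_ge
  let s₀ : Metric.sphere (0 : Space d) 1 := ⟨σ, by simpa using hσ⟩
  let p₀ : Space d × Metric.sphere (0 : Space d) 1 := (w, s₀)
  have hc1 : ContinuousAt
      (fun p : Space d × Metric.sphere (0 : Space d) 1 => ‖v - p.1‖) p₀ := by fun_prop
  have hc2 : ContinuousAt
      (fun p : Space d × Metric.sphere (0 : Space d) 1 => cosAngle v p.1 p.2) p₀ := by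
    have : ‖v - p₀.1‖ ≠ 0 := (norm_pos_iff.2 (sub_ne_zero.2 hvw)).ne'
    unfold cosAngle
    fun_prop (disch := assumption)
  have hc20 : cosAngle v p₀.1 p₀.2 = 0 := by
    simp only [cosAngle, p₀, s₀]
    rw [inner_smul_left, horth, mul_zero]
  have hc3 : ContinuousAt (fun p : Space d × Metric.sphere (0 : Space d) 1 =>
      g (postVel v p.1 p.2)) p₀ := by
    unfold postVel
    fun_prop
  have hc4 : ContinuousAt (fun p : Space d × Metric.sphere (0 : Space d) 1 =>
      g (postVelStar v p.1 p.2)) p₀ := by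
    unfold postVelStar
    fun_prop
  have e1 := hc1.eventually hΦ'
  rw [← hc20] at hb'
  have e2 := hc2.eventually hb'
  have e3 := hc3.eventually (lt_mem_nhds (half_lt_self h1))
  have e4 := hc4.eventually (lt_mem_nhds (half_lt_self h2))
  -- All four factors of the integrand are bounded below near `(w, σ)`, and non-empty open sets have
  -- positive measure for `dv_* dσ`.
  obtain ⟨U, hU, hUo, hpU⟩ := eventually_nhds_iff.1 (e1.and (e2.and (e3.and e4)))
  set c := cΦ * cb * (g (postVel v w σ) / 2) * (g (postVelStar v w σ) / 2) with hc
  have hcpos : 0 < c := by positivity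
  calc (0 : ℝ≥0∞) < ENNReal.ofReal c *
        ((volume : Measure (Space d)).prod (volume : Measure (Space d)).toSphere) U :=
        ENNReal.mul_pos (ENNReal.ofReal_pos.2 hcpos).ne' (hUo.measure_pos _ ⟨p₀, hpU⟩).ne'
    _ = ∫⁻ _ in U, ENNReal.ofReal c
        ∂((volume : Measure (Space d)).prod (volume : Measure (Space d)).toSphere) := by simp
    _ ≤ ∫⁻ p in U, ENNReal.ofReal (Φ ‖v - p.1‖ * b (cosAngle v p.1 p.2) *
          g (postVel v p.1 p.2) * g (postVelStar v p.1 p.2))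
        ∂((volume : Measure (Space d)).prod (volume : Measure (Space d)).toSphere) := by
        refine setLIntegral_mono' hUo.measurableSet fun p hp => ENNReal.ofReal_le_ofReal ?_
        obtain ⟨i1, i2, i3, i4⟩ := hU p hp
        have j3 := i3.le
        have j4 := i4.le
        simp only [p₀, s₀] at j3 j4
        have hΦ0 := hcΦ.le.trans i1
        have hb0 := hcb.le.trans i2
        have hg0 := (half_pos h1).le.trans j3
        rw [hc]
        gcongr
    _ ≤ gainQ Φ b g g v := setLIntegral_le_lintegral _ _

/-- Positivity on a ball spreads, through the gain operator, to a ball larger by `√2`. -/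
theorem gainQ_self_pos_of_ball {d : ℕ} (hd : 2 ≤ d) {Φ b : ℝ → ℝ} {γ ν : ℝ}
    (hΦ : IsPowerKernel Φ γ ∨ IsMollifiedKernel Φ γ) (hb : IsAngularKernel d b ν)
    {g : Space d → ℝ} (hg : Continuous g) {v₀ v : Space d} {R : ℝ}
    (hpos : ∀ u ∈ Metric.ball v₀ R, 0 < g u) (hv : v ∈ Metric.ball v₀ (Real.sqrt 2 * R)) :
    0 < gainQ Φ b g g v := by
  rw [mem_ball_iff_norm] at hv
  have hR : 0 < R := by
    have := (norm_nonneg _).trans_lt hv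
    exact pos_of_mul_pos_right this (Real.sqrt_nonneg 2)
  -- Here the partner `v₀` would give a degenerate collision. A partner at distance `R / 2` is used
  -- instead; both outputs stay within `R / 4 + R / 4` of `v₀`.
  by_cases hvv : v = v₀
  · subst hvv
    obtain ⟨e, he, -⟩ := exists_unit_orthogonal hd (0 : Space d)
    obtain ⟨σ, hσ, hσ'⟩ := exists_unit_orthogonal hd ((R / 2) • e)
    have hn : ‖(R / 2) • e‖ = R / 2 := by
      rw [norm_smul, he, mul_one, Real.norm_of_nonneg (by positivity)]
    have hvw : v - (v - (R / 2) • e) = (R / 2) • e := by abel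
    have hne : v ≠ v - (R / 2) • e := by
      intro h
      rw [eq_comm, sub_eq_self] at h
      rw [h, norm_zero] at hn
      linarith
    have hb1 : ‖(1 / 2 : ℝ) • ((R / 2) • e)‖ = R / 4 := by
      rw [norm_smul, hn]; norm_num; ring
    have hb2 : ‖(R / 2 / 2) • σ‖ = R / 4 := by
      rw [norm_smul, hσ, mul_one, Real.norm_of_nonneg (by positivity)]; ring
    refine gainQ_self_pos hΦ hb hg hne hσ (by rwa [hvw]) (hpos _ ?_) (hpos _ ?_)
    · rw [mem_ball_iff_norm, postVel, hvw, hn]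
      have : (1 / 2 : ℝ) • (v + (v - (R / 2) • e)) + (R / 2 / 2) • σ - v =
        (R / 2 / 2) • σ - (1 / 2 : ℝ) • ((R / 2) • e) := by module
      rw [this]
      have := norm_sub_le ((R / 2 / 2) • σ) ((1 / 2 : ℝ) • ((R / 2) • e))
      linarith
    · rw [mem_ball_iff_norm, postVelStar, hvw, hn]
      have : (1 / 2 : ℝ) • (v + (v - (R / 2) • e)) - (R / 2 / 2) • σ - v =
        -((R / 2 / 2) • σ + (1 / 2 : ℝ) • ((R / 2) • e)) := by module
      rw [this, norm_neg]
      have := norm_add_le ((R / 2 / 2) • σ) ((1 / 2 : ℝ) • ((R / 2) • e))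
      linarith
  · obtain ⟨σ, hσ, hσ'⟩ := exists_unit_orthogonal hd (v - v₀)
    -- The signs `ε = ±1` give the two output velocities relative to `v₀`; by orthogonality the
    -- squared norm is `‖v - v₀‖² / 2`.
    have hn : ∀ ε : ℝ, ε ^ 2 = 1 →
        ‖(1 / 2 : ℝ) • (v - v₀) + (ε * (‖v - v₀‖ / 2)) • σ‖ < R := by
      intro ε hε
      refine lt_of_pow_lt_pow_left₀ 2 hR.le ?_
      rw [norm_add_sq_real, inner_smul_left, inner_smul_right, hσ', norm_smul, norm_smul, hσ,
        mul_one, mul_pow, Real.norm_eq_abs, Real.norm_eq_abs, sq_abs, sq_abs]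
      have h3 : ‖v - v₀‖ ^ 2 < 2 * R ^ 2 := by
        calc ‖v - v₀‖ ^ 2 < (Real.sqrt 2 * R) ^ 2 := pow_lt_pow_left₀ hv (norm_nonneg _) two_ne_zero
          _ = 2 * R ^ 2 := by rw [mul_pow, Real.sq_sqrt zero_le_two]
      rw [mul_pow, hε]
      nlinarith
    refine gainQ_self_pos hΦ hb hg hvv hσ hσ' (hpos _ ?_) (hpos _ ?_)
    · rw [mem_ball_iff_norm, postVel]
      refine (congrArg norm ?_).trans_lt (hn 1 (by norm_num))
      module
    · rw [mem_ball_iff_norm, postVelStar]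
      refine (congrArg norm ?_).trans_lt (hn (-1) (by norm_num))
      module

/-! ### Positivity along characteristics -/

section Characteristics

variable {d : ℕ} {Ω : Set (Space d)} {Φ b : ℝ → ℝ} {Tw : ℝ} {T : EReal}
  {f₀ : Space d → Space d → ℝ} {f : ℝ → Space d → Space d → ℝ}

/-- Backing a point off along its trajectory leaves the trajectory unchanged. The Duhamel formula,
available only at points of `Ω`, can thus serve trajectories ending on the boundary. -/
theorem charX_sub_smul (u t ε : ℝ) (x v : Space d) :
    charX u (t - ε) (x - ε • v) v = charX u t x v := by
  unfold charX
  module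

theorem timeInterval_of_le {t s : ℝ} (ht : t ∈ timeInterval T) (hs : 0 ≤ s) (hst : s ≤ t) :
    s ∈ timeInterval T :=
  ⟨hs, (EReal.coe_le_coe_iff.2 hst).trans_lt ht.2⟩

theorem measurableSet_insideTimes (Ω : Set (Space d)) (T' t : ℝ) (x v : Space d) :
    MeasurableSet (insideTimes Ω T' t x v) := by
  have hc : Continuous fun s : ℝ => charX s t x v := by
    unfold charX
    fun_prop
  exact measurableSet_Icc.inter (isClosed_closure.preimage hc).measurableSet

/-- The backward exit time is bounded below by the time spent inside an open set. -/
theorem le_exitTime (hΩ : IsOpen Ω) {x v : Space d} {r : ℝ}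
    (h : ∀ q, 0 ≤ q → q < r → x - q • v ∈ Ω) : ENNReal.ofReal r ≤ exitTime Ω x v := by
  refine le_iInf₂ fun q hq => ENNReal.ofReal_le_ofReal ?_
  by_contra! hlt
  have := hq.2
  rw [hΩ.frontier_eq] at this
  exact this.2 (h q hq.1 hlt)

/-- The damping factor is bounded below on a portion of a characteristic inside the domain. -/
theorem IsMildSolution.exists_le_damping (hf : IsMildSolution Ω Φ b Tw T f₀ f) {t : ℝ}
    {x v : Space d} {s₁ : ℝ} (hs₁ : 0 ≤ s₁) (hs₁t : s₁ < t) (ht : t ∈ timeInterval T)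
    (hin : ∀ s, s₁ ≤ s → s < t → charX s t x v ∈ Ω) (hx : x ∈ closure Ω) :
    ∃ c : ℝ≥0∞, 0 < c ∧ ∀ ε s, 0 ≤ ε → s₁ ≤ s → s ≤ t - ε →
      c ≤ damping Φ b f s (t - ε) (x - ε • v) v := by
  have htI := timeInterval_of_le ht hs₁ hs₁t.le
  -- Integrability is based at the position at time `s₁`, which lies in `Ω`, since `x` itself may be
  -- on the boundary.
  have hloss := hf.loss_locallyIntegrable s₁ htI (charX s₁ t x v) (hin s₁ le_rfl hs₁t) v t ht
  have hX : ∀ u, charX u s₁ (charX s₁ t x v) v = charX u t x v := by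
    intro u
    unfold charX
    module
  simp only [hX] at hloss
  have hint := integrable_toReal_of_lintegral_ne_top hloss.1 hloss.2.ne
  refine ⟨ENNReal.ofReal (Real.exp (-∫ u in insideTimes Ω t s₁ (charX s₁ t x v) v,
    (lossL Φ b (f u (charX u t x v)) v).toReal)), ENNReal.ofReal_pos.2 (Real.exp_pos _), ?_⟩
  intro ε s hε hs hst
  unfold damping
  simp only [charX_sub_smul]
  refine ENNReal.ofReal_le_ofReal (Real.exp_le_exp.2 (neg_le_neg ?_))
  rw [intervalIntegral.integral_of_le hst]
  refine setIntegral_mono_set hint (ae_of_all _ fun u => ENNReal.toReal_nonneg) ?_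
  refine LE.le.eventuallyLE fun u hu => ?_
  refine ⟨⟨by linarith [hu.1], by linarith [hu.2]⟩, ?_⟩
  rw [hX]
  rcases lt_or_ge u t with h | h
  · exact subset_closure (hin u (by linarith [hu.1]) h)
  · have : u = t := by linarith [hu.2]
    subst this
    simpa [charX] using hx

/-- Positivity of the gain term along the characteristic through `(t, x, v)` makes `f` positive
at `(t, x, v)`, including at non-grazing boundary points. -/
theorem IsMildSolution.pos_of_gain (hf : IsMildSolution Ω Φ b Tw T f₀ f) (hΩ : IsOpen Ω)
    (hf_cont : ContinuousOn (fun p : ℝ × Space d × Space d => f p.1 p.2.1 p.2.2)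
      (timeInterval T ×ˢ ((closure Ω ×ˢ univ) \ grazingSet Ω)))
    {t : ℝ} {x v : Space d} {s₁ s₂ : ℝ} (hs₁ : 0 ≤ s₁) (hs₁₂ : s₁ < s₂) (hs₂ : s₂ < t)
    (ht : t ∈ timeInterval T) (hin : ∀ s, s₁ ≤ s → s < t → charX s t x v ∈ Ω)
    (hx : x ∈ closure Ω) (hxv : (x, v) ∉ grazingSet Ω)
    (hgain : ∀ s ∈ Ioc s₁ s₂, 0 < gainQ Φ b (f s (charX s t x v)) (f s (charX s t x v)) v) :
    0 < f t x v := by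
  obtain ⟨c, hc, hdamp⟩ := hf.exists_le_damping hs₁ (hs₁₂.trans hs₂) ht hin hx
  set G : ℝ → ℝ≥0∞ := fun s => gainQ Φ b (f s (charX s t x v)) (f s (charX s t x v)) v with hG
  have hX : ∀ u, charX u s₁ (charX s₁ t x v) v = charX u t x v := by
    intro u
    unfold charX
    module
  have hGmeas : AEMeasurable G (volume.restrict (Ioc s₁ s₂)) := by
    have h := (hf.gain_locallyIntegrable s₁ (timeInterval_of_le ht hs₁ (hs₁₂.trans hs₂).le)
      (charX s₁ t x v) (hin s₁ le_rfl (hs₁₂.trans hs₂)) v t ht).1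
    simp only [hX] at h
    refine h.mono_measure (Measure.restrict_mono (fun u hu => ?_) le_rfl)
    refine ⟨⟨by linarith [hu.1], by linarith [hu.2]⟩, ?_⟩
    rw [hX]
    exact subset_closure (hin u hu.1.le (hu.2.trans_lt hs₂))
  have hGpos : 0 < ∫⁻ s in Ioc s₁ s₂, G s := by
    rw [pos_iff_ne_zero, Ne, lintegral_eq_zero_iff' hGmeas]
    intro h
    rw [EventuallyEq, ae_restrict_iff' measurableSet_Ioc] at h
    have h0 : volume (Ioc s₁ s₂) = 0 := by
      refine measure_mono_null (fun s hs => ?_) h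
      exact fun h' => (hgain s hs).ne' (h' hs)
    rw [Real.volume_Ioc, ENNReal.ofReal_eq_zero] at h0
    linarith
  have hK : 0 < c * ∫⁻ s in Ioc s₁ s₂, G s := ENNReal.mul_pos hc.ne' hGpos.ne'
  have hlow : ∀ ε, 0 < ε → ε < t - s₂ →
      c * ∫⁻ s in Ioc s₁ s₂, G s ≤ ENNReal.ofReal (f (t - ε) (x - ε • v) v) := by
    intro ε hε hε'
    have hduh : ∀ a, a ≤ s₁ →
        c * ∫⁻ s in Ioc s₁ s₂, G s ≤ duhamelGain Φ b f a (t - ε) (x - ε • v) v := by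
      intro a ha
      calc c * ∫⁻ s in Ioc s₁ s₂, G s ≤ ∫⁻ s in Ioc s₁ s₂, c * G s :=
            lintegral_const_mul_le _ _
        _ ≤ ∫⁻ s in Ioc s₁ s₂, damping Φ b f s (t - ε) (x - ε • v) v * G s := by
            refine setLIntegral_mono' measurableSet_Ioc fun s hs => ?_
            gcongr
            exact hdamp ε s hε.le hs.1.le (by linarith [hs.2])
        _ ≤ duhamelGain Φ b f a (t - ε) (x - ε • v) v := by
            unfold duhamelGain
            simp only [charX_sub_smul]
            exact lintegral_mono_set (Ioc_subset_Ioc ha (by linarith))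
    have htε : t - ε ∈ timeInterval T := timeInterval_of_le ht (by linarith) (by linarith)
    have hxε : x - ε • v ∈ Ω := by
      have := hin (t - ε) (by linarith) (by linarith)
      simpa [charX] using this
    rcases le_or_gt (ENNReal.ofReal (t - ε)) (exitTime Ω (x - ε • v) v) with h | h
    · rw [hf.duhamel_initial _ htε _ hxε v h]
      exact (hduh 0 hs₁).trans le_add_self
    · rw [hf.duhamel_wall _ htε _ hxε v h]
      refine (hduh _ ?_).trans le_add_self
      -- The last wall contact is no later than `s₁`, so the Duhamel integral covers all of `Ioc s₁
      -- s₂`.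
      have h1 : ENNReal.ofReal (t - ε - s₁) ≤ exitTime Ω (x - ε • v) v := by
        refine le_exitTime hΩ fun q hq hq' => ?_
        have := hin (t - ε - q) (by linarith) (by linarith)
        rwa [← charX_sub_smul _ _ ε, charX, sub_sub_cancel] at this
      have h2 := (ENNReal.ofReal_le_iff_le_toReal (h.trans ENNReal.ofReal_lt_top).ne).1 h1
      linarith
  have hmaps : ∀ᶠ ε in 𝓝[>] (0 : ℝ), (t - ε, x - ε • v, v) ∈
      timeInterval T ×ˢ ((closure Ω ×ˢ univ) \ grazingSet Ω) := by
    filter_upwards [Ioo_mem_nhdsGT (sub_pos.2 hs₂)] with ε hε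
    have hxε : x - ε • v ∈ Ω := by
      have := hin (t - ε) (by linarith [hε.2]) (by linarith [hε.1])
      simpa [charX] using this
    refine ⟨timeInterval_of_le ht (by linarith [hε.2]) (by linarith [hε.1]),
      ⟨subset_closure hxε, mem_univ _⟩, fun h => ?_⟩
    have := h.1
    rw [hΩ.frontier_eq] at this
    exact this.2 hxε
  have hcurve : Tendsto (fun ε : ℝ => (t - ε, x - ε • v, v)) (𝓝[>] 0) (𝓝 (t, x, v)) := by
    have : Continuous fun ε : ℝ => (t - ε, x - ε • v, v) := by fun_prop
    simpa using (this.tendsto 0).mono_left nhdsWithin_le_nhds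
  -- The lower bound does not depend on `ε`, so it survives the limit `ε → 0`; continuity at the
  -- endpoint is where non-grazing enters.
  have hlim : Tendsto (fun ε : ℝ => ENNReal.ofReal (f (t - ε) (x - ε • v) v)) (𝓝[>] 0)
      (𝓝 (ENNReal.ofReal (f t x v))) := by
    refine (ENNReal.continuous_ofReal.tendsto _).comp ?_
    exact (hf_cont (t, x, v) ⟨ht, ⟨hx, mem_univ _⟩, hxv⟩).tendsto.comp
      (tendsto_nhdsWithin_iff.2 ⟨hcurve, hmaps⟩)
  have := ge_of_tendsto hlim (by
    filter_upwards [Ioo_mem_nhdsGT (sub_pos.2 hs₂)] with ε hε using hlow ε hε.1 hε.2)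
  exact ENNReal.ofReal_pos.1 (hK.trans_le this)

end Characteristics

/-! ### Transversality at a convex boundary -/

/-- An inner ball of radius `ε` at `x₀` makes the rays from `x₀` uniformly transverse to the
boundary of a convex domain. -/
theorem IsC2Domain.le_inner_outwardNormal {d : ℕ} {Ω : Set (Space d)} (hΩ : IsC2Domain Ω)
    (hconv : Convex ℝ Ω) {x₀ : Space d} {ε : ℝ} (hε : 0 ≤ ε)
    (hball : Metric.closedBall x₀ ε ⊆ Ω) {x : Space d} (hx : x ∈ frontier Ω) :
    ε ≤ ⟪x - x₀, outwardNormal Ω x⟫ := by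
  obtain ⟨hn, ξ, -, ⟨c, hc, hgrad⟩, hξ⟩ := hΩ.outwardNormal_spec hx
  set n := outwardNormal Ω x
  have hxΩ : x ∉ Ω := by
    rw [hΩ.isOpen.frontier_eq] at hx
    exact hx.2
  have hxc : x ∈ closure Ω := frontier_subset_closure hx
  have hξx : 0 ≤ ξ x := not_lt.1 fun h => hxΩ (hξ.self_of_nhds.2 h)
  have hy : x₀ + ε • n ∈ Ω := hball (by simp [norm_smul, hn, abs_of_nonneg hε])
  set w := x₀ + ε • n - x with hw
  have hline : HasDerivAt (fun r : ℝ => ξ (x + r • w)) (⟪c • n, w⟫) 0 := by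
    have h1 : HasDerivAt (fun r : ℝ => x + r • w) w 0 := by
      simpa using ((hasDerivAt_id (0 : ℝ)).smul_const w).const_add x
    have h2 : HasFDerivAt ξ (InnerProductSpace.toDual ℝ (Space d) (c • n)) (x + (0 : ℝ) • w) := by
      simpa using hgrad.hasFDerivAt
    exact h2.comp_hasDerivAt (0 : ℝ) h1
  -- The segment from `x` to `x₀ + ε • n` enters `Ω`, where `ξ < 0 ≤ ξ x`, so the right derivative
  -- of `ξ` along it is non-positive.
  have hnonpos : ⟪c • n, w⟫ ≤ 0 := by
    have hslope := (hasDerivWithinAt_iff_tendsto_slope' (s := Ioi (0 : ℝ)) (by simp)).1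
      hline.hasDerivWithinAt
    refine le_of_tendsto hslope ?_
    have hcont : Tendsto (fun r : ℝ => x + r • w) (𝓝[>] 0) (𝓝 x) := by
      have : Continuous fun r : ℝ => x + r • w := by fun_prop
      simpa using (this.tendsto 0).mono_left nhdsWithin_le_nhds
    filter_upwards [hcont.eventually hξ, Ioo_mem_nhdsGT one_pos] with r hr hr1
    have hin : x + r • w ∈ Ω := by
      have := hconv.combo_interior_closure_mem_interior (x := x₀ + ε • n) (y := x)
        (by rwa [hΩ.isOpen.interior_eq]) hxc hr1.1 (sub_nonneg.2 hr1.2.le) (by ring)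
      rw [hΩ.isOpen.interior_eq] at this
      convert this using 1
      rw [hw]
      module
    have hneg := hr.1 hin
    rw [slope_def_field]
    have : ξ (x + r • w) - ξ (x + (0 : ℝ) • w) ≤ 0 := by
      rw [zero_smul, add_zero]
      linarith
    exact div_nonpos_of_nonpos_of_nonneg this (by linarith [hr1.1])
  rw [inner_smul_left, RCLike.conj_to_real] at hnonpos
  have h3 : ⟪n, w⟫ ≤ 0 := nonpos_of_mul_nonpos_right hnonpos hc
  have h4 : ⟪n, w⟫ = ε - ⟪x - x₀, n⟫ := by
    rw [hw, show x₀ + ε • n - x = ε • n - (x - x₀) by abel, inner_sub_right, inner_smul_right,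
      real_inner_self_eq_norm_sq, hn, real_inner_comm]
    ring
  linarith

/-! ### Spreading of positivity in velocity -/

section Spreading

variable {d : ℕ} {Ω : Set (Space d)} {Φ b : ℝ → ℝ} {γ ν Tw : ℝ} {T : EReal}
  {f₀ : Space d → Space d → ℝ} {f : ℝ → Space d → Space d → ℝ}

theorem notMem_grazingSet_of_mem (hΩ : IsOpen Ω) {x : Space d} (hx : x ∈ Ω) (v : Space d) :
    (x, v) ∉ grazingSet Ω := by
  intro h
  have := h.1
  rw [hΩ.frontier_eq] at this
  exact this.2 hx

theorem continuous_velocity_of_mem (hΩ : IsOpen Ω)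
    (hf_cont : ContinuousOn (fun p : ℝ × Space d × Space d => f p.1 p.2.1 p.2.2)
      (timeInterval T ×ˢ ((closure Ω ×ˢ univ) \ grazingSet Ω)))
    {t : ℝ} (ht : t ∈ timeInterval T) {x : Space d} (hx : x ∈ Ω) : Continuous (f t x) := by
  refine hf_cont.comp_continuous (f := fun v : Space d => (t, x, v)) (by fun_prop) fun v => ?_
  exact ⟨ht, ⟨subset_closure hx, mem_univ _⟩, notMem_grazingSet_of_mem hΩ hx v⟩

theorem exists_pos_of_totalMass_pos {g : Space d → Space d → ℝ} (h : 0 < totalMass Ω g)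
    (hΩ : IsOpen Ω) : ∃ x ∈ Ω, ∃ v, 0 < g x v := by
  by_contra! hcon
  refine h.ne' ?_
  unfold totalMass
  rw [setLIntegral_congr_fun (g := fun _ => 0) hΩ.measurableSet]
  · simp
  · intro x hx
    simp [ENNReal.ofReal_eq_zero.2 (hcon x hx _)]

/-- `f` is positive for short positive times, near `x₀`, for velocities in `ball v₀ R`. -/
def PositiveOnCylinder (f : ℝ → Space d → Space d → ℝ) (Ω : Set (Space d)) (T : EReal)
    (x₀ v₀ : Space d) (R : ℝ) : Prop :=
  ∃ τ ρ : ℝ, 0 < τ ∧ 0 < ρ ∧ τ ∈ timeInterval T ∧ Metric.ball x₀ ρ ⊆ Ω ∧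
    ∀ s ∈ Ioo 0 τ, ∀ x ∈ Metric.ball x₀ ρ, ∀ v ∈ Metric.ball v₀ R, 0 < f s x v

theorem PositiveOnCylinder.mono {x₀ v₀ : Space d} {R R' : ℝ}
    (h : PositiveOnCylinder f Ω T x₀ v₀ R) (hR : R' ≤ R) :
    PositiveOnCylinder f Ω T x₀ v₀ R' := by
  obtain ⟨τ, ρ, h1, h2, h3, h4, h5⟩ := h
  exact ⟨τ, ρ, h1, h2, h3, h4, fun s hs x hx v hv => h5 s hs x hx v (Metric.ball_subset_ball hR hv)⟩

theorem exists_mem_timeInterval_of_lt {t : ℝ} (ht : t ∈ timeInterval T) :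
    ∃ t' ∈ timeInterval T, t < t' := by
  obtain ⟨q, hq1, hq2⟩ := EReal.lt_iff_exists_real_btwn.1 ht.2
  have hq := EReal.coe_lt_coe_iff.1 hq1
  exact ⟨q, ⟨ht.1.trans hq.le, hq2⟩, hq⟩

theorem positiveOnCylinder_of_initial (hΩ : IsOpen Ω)
    (hf_cont : ContinuousOn (fun p : ℝ × Space d × Space d => f p.1 p.2.1 p.2.2)
      (timeInterval T ×ˢ ((closure Ω ×ˢ univ) \ grazingSet Ω)))
    (h0 : (0 : ℝ) ∈ timeInterval T) {x₀ v₀ : Space d} (hx₀ : x₀ ∈ Ω) (hpos : 0 < f 0 x₀ v₀) :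
    ∃ R : ℝ, 0 < R ∧ PositiveOnCylinder f Ω T x₀ v₀ R := by
  have hc := hf_cont (0, x₀, v₀)
    ⟨h0, ⟨subset_closure hx₀, mem_univ _⟩, notMem_grazingSet_of_mem hΩ hx₀ v₀⟩
  have hev := hc.eventually (lt_mem_nhds hpos)
  obtain ⟨δ, hδ, hδ'⟩ := Metric.mem_nhdsWithin_iff.1 hev
  obtain ⟨η, hη, hη'⟩ := Metric.isOpen_iff.1 hΩ x₀ hx₀
  obtain ⟨t', ht', ht0⟩ := exists_mem_timeInterval_of_lt h0
  have hτ : 0 < min δ t' := lt_min hδ ht0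
  refine ⟨δ, hδ, min δ t', min δ η, hτ, lt_min hδ hη,
    timeInterval_of_le ht' hτ.le (min_le_right _ _),
    (Metric.ball_subset_ball (min_le_right _ _)).trans hη', fun s hs x hx v hv => ?_⟩
  have hxΩ : x ∈ Ω := hη' (Metric.ball_subset_ball (min_le_right _ _) hx)
  refine @hδ' (s, x, v) ⟨?_, timeInterval_of_le ht' hs.1.le (hs.2.le.trans (min_le_right _ _)),
    ⟨subset_closure hxΩ, mem_univ _⟩, notMem_grazingSet_of_mem hΩ hxΩ v⟩
  rw [Metric.mem_ball, Prod.dist_eq, Prod.dist_eq]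
  refine max_lt ?_ (max_lt (Metric.ball_subset_ball (min_le_left _ _) hx) hv)
  rw [Real.dist_eq, sub_zero, abs_of_pos hs.1]
  exact hs.2.trans_le (min_le_left _ _)

/-- For short times, trajectories ending in the half-size ball never leave the original one, so the
gain is positive at every time in `(0, t)` and `pos_of_gain` applies. -/
theorem IsMildSolution.positiveOnCylinder_sqrt_two_mul (hf : IsMildSolution Ω Φ b Tw T f₀ f)
    (hd : 2 ≤ d) (hΦ : IsPowerKernel Φ γ ∨ IsMollifiedKernel Φ γ) (hb : IsAngularKernel d b ν)
    (hΩ : IsOpen Ω)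
    (hf_cont : ContinuousOn (fun p : ℝ × Space d × Space d => f p.1 p.2.1 p.2.2)
      (timeInterval T ×ˢ ((closure Ω ×ˢ univ) \ grazingSet Ω)))
    {x₀ v₀ : Space d} {R : ℝ} (hR : 0 < R) (h : PositiveOnCylinder f Ω T x₀ v₀ R) :
    PositiveOnCylinder f Ω T x₀ v₀ (Real.sqrt 2 * R) := by
  obtain ⟨τ, ρ, hτ, hρ, hτT, hball, hpos⟩ := h
  -- `V` bounds the speeds in the enlarged ball; before time `ρ / 2 / V` the displacement is less
  -- than `ρ / 2`.
  set V := ‖v₀‖ + Real.sqrt 2 * R with hV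
  have hVpos : 0 < V := by positivity
  have hτ' : 0 < min τ (ρ / 2 / V) := lt_min hτ (by positivity)
  refine ⟨min τ (ρ / 2 / V), ρ / 2, hτ', half_pos hρ,
    timeInterval_of_le hτT hτ'.le (min_le_left _ _),
    (Metric.ball_subset_ball (by linarith)).trans hball, fun t ht x hx v hv => ?_⟩
  have htτ : t < τ := ht.2.trans_le (min_le_left _ _)
  have htV : t * V < ρ / 2 := (lt_div_iff₀ hVpos).1 (ht.2.trans_le (min_le_right _ _))
  have hvV : ‖v‖ ≤ V := by
    have h1 := mem_ball_iff_norm.1 hv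
    have h2 := norm_add_le v₀ (v - v₀)
    rw [add_sub_cancel] at h2
    linarith
  have hxin : ∀ s, 0 ≤ s → s ≤ t → charX s t x v ∈ Metric.ball x₀ ρ := by
    intro s hs hst
    have h1 : ‖(t - s) • v‖ ≤ t * V := by
      rw [norm_smul, Real.norm_of_nonneg (by linarith)]
      exact mul_le_mul (by linarith) hvV (norm_nonneg v) ht.1.le
    have h2 := mem_ball_iff_norm.1 hx
    rw [mem_ball_iff_norm, charX, sub_right_comm]
    have h3 := norm_sub_le (x - x₀) ((t - s) • v)
    linarith
  have hxΩ : x ∈ Ω := hball (Metric.ball_subset_ball (by linarith) hx)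
  have htT : t ∈ timeInterval T := timeInterval_of_le hτT ht.1.le htτ.le
  refine hf.pos_of_gain hΩ hf_cont le_rfl (half_pos ht.1) (half_lt_self ht.1) htT
    (fun s hs hst => hball (hxin s hs hst.le)) (subset_closure hxΩ)
    (notMem_grazingSet_of_mem hΩ hxΩ v) fun s hs => ?_
  have hst : s ≤ t := by linarith [hs.2, ht.1]
  have hsx := hxin s hs.1.le hst
  exact gainQ_self_pos_of_ball hd hΦ hb (continuous_velocity_of_mem hΩ hf_cont
    (timeInterval_of_le htT hs.1.le hst) (hball hsx))
    (hpos s ⟨hs.1, hst.trans_lt htτ⟩ _ hsx) hv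

/-- Each `R` takes finitely many dilations by `√2`. As `x₀` and `v₀` are fixed before `R`, the
radius may later depend on `v₀`. -/
theorem IsMildSolution.exists_positiveOnCylinder (hf : IsMildSolution Ω Φ b Tw T f₀ f)
    (hd : 2 ≤ d) (hΦ : IsPowerKernel Φ γ ∨ IsMollifiedKernel Φ γ) (hb : IsAngularKernel d b ν)
    (hΩ : IsOpen Ω)
    (hf_cont : ContinuousOn (fun p : ℝ × Space d × Space d => f p.1 p.2.1 p.2.2)
      (timeInterval T ×ˢ ((closure Ω ×ˢ univ) \ grazingSet Ω)))
    (h0 : (0 : ℝ) ∈ timeInterval T) (hM : 0 < totalMass Ω (f 0)) :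
    ∃ x₀ ∈ Ω, ∃ v₀, ∀ R, PositiveOnCylinder f Ω T x₀ v₀ R := by
  obtain ⟨x₀, hx₀, v₀, hpos⟩ := exists_pos_of_totalMass_pos hM hΩ
  refine ⟨x₀, hx₀, v₀, fun R => ?_⟩
  obtain ⟨r, hr, hr'⟩ := positiveOnCylinder_of_initial hΩ hf_cont h0 hx₀ hpos
  have hpow : ∀ k : ℕ, PositiveOnCylinder f Ω T x₀ v₀ (Real.sqrt 2 ^ k * r) := by
    intro k
    induction k with
    | zero => simpa using hr'
    | succ k ih =>
      rw [pow_succ', mul_assoc]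
      exact hf.positiveOnCylinder_sqrt_two_mul hd hΦ hb hΩ hf_cont (by positivity) ih
  obtain ⟨k, hk⟩ := pow_unbounded_of_one_lt (R / r) Real.one_lt_sqrt_two
  exact (hpow k).mono ((div_lt_iff₀ hr).1 hk).le

end Spreading

/-! ### Arrival at the wall and outgoing flux -/

section BoundaryFlux

variable {d : ℕ} {Ω : Set (Space d)} {Φ b : ℝ → ℝ} {γ ν Tw : ℝ} {T : EReal}
  {f₀ : Space d → Space d → ℝ} {f : ℝ → Space d → Space d → ℝ}

theorem wallMaxwellian_pos (hTw : 0 < Tw) (v : Space d) : 0 < wallMaxwellian Tw v := by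
  unfold wallMaxwellian
  positivity

/-- A segment from a point of a convex open set to a point of its closure lies in the set, up to
the latter endpoint. -/
theorem add_smul_sub_mem_of_mem_closure (hΩ : IsOpen Ω) (hconv : Convex ℝ Ω) {y x : Space d}
    (hy : y ∈ Ω) (hx : x ∈ closure Ω) {r : ℝ} (hr : 0 < r) (hr1 : r ≤ 1) :
    x + r • (y - x) ∈ Ω := by
  have := hconv.combo_interior_closure_mem_interior (x := y) (y := x)
    (by rwa [hΩ.interior_eq]) hx hr (sub_nonneg.2 hr1) (by ring)
  rw [hΩ.interior_eq] at this
  convert this using 1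
  module

/-- The outgoing flux at a boundary point is finite at positive times, since it governs the
finite values of `f` on the characteristics issued from that point. -/
theorem IsMildSolution.outgoingFlux_lt_top (hf : IsMildSolution Ω Φ b Tw T f₀ f)
    (hTw : 0 < Tw) (hΩ : IsOpen Ω) (hconv : Convex ℝ Ω) {x₀ : Space d} (hx₀ : x₀ ∈ Ω)
    {t : ℝ} (ht0 : 0 < t) (ht : t ∈ timeInterval T) {x : Space d} (hx : x ∈ frontier Ω) :
    outgoingFlux Ω (f t x) x < ∞ := by
  obtain ⟨t', ht', htt'⟩ := exists_mem_timeInterval_of_lt ht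
  -- The trajectory leaving the wall at `(t, x)` towards `x₀` is observed a time `r` later, with
  -- backward exit time exactly `r`; an infinite flux would make `f` infinite there.
  set r := min 1 (t' - t) with hr
  have hr0 : 0 < r := lt_min one_pos (sub_pos.2 htt')
  have hr1 : r ≤ 1 := min_le_left _ _
  have hrt : t + r ≤ t' := by linarith [min_le_right 1 (t' - t)]
  set w := x₀ - x with hw
  have hxc := frontier_subset_closure hx
  have hback : x + r • w - r • w = x := by abel
  have hexit : exitTime Ω (x + r • w) w = ENNReal.ofReal r := by
    refine le_antisymm (iInf₂_le r ⟨hr0.le, by rwa [hback]⟩) (le_exitTime hΩ fun q hq hqr => ?_)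
    have := add_smul_sub_mem_of_mem_closure hΩ hconv hx₀ hxc (sub_pos.2 hqr) (by linarith)
    convert this using 1
    rw [hw]
    module
  have htr : t + r ∈ timeInterval T := timeInterval_of_le ht' (by linarith) hrt
  have hduh := hf.duhamel_wall (t + r) htr (x + r • w)
    (add_smul_sub_mem_of_mem_closure hΩ hconv hx₀ hxc hr0 hr1) w (by
      rw [hexit]
      exact (ENNReal.ofReal_lt_ofReal_iff (by linarith)).2 (by linarith))
  rw [hexit, ENNReal.toReal_ofReal hr0.le, hback, add_sub_cancel_right] at hduh
  by_contra htop
  rw [not_lt, top_le_iff] at htop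
  have hM : ENNReal.ofReal (wallMaxwellian Tw w) ≠ 0 :=
    (ENNReal.ofReal_pos.2 (wallMaxwellian_pos hTw w)).ne'
  have hD : damping Φ b f t (t + r) (x + r • w) w ≠ 0 :=
    (ENNReal.ofReal_pos.2 (Real.exp_pos _)).ne'
  rw [wallEmission, htop, ENNReal.top_mul hM, ENNReal.top_mul hD, top_add] at hduh
  exact ENNReal.ofReal_ne_top hduh

theorem aestronglyMeasurable_outgoing
    (hf_cont : ContinuousOn (fun p : ℝ × Space d × Space d => f p.1 p.2.1 p.2.2)
      (timeInterval T ×ˢ ((closure Ω ×ˢ univ) \ grazingSet Ω)))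
    {t : ℝ} (ht : t ∈ timeInterval T) {x : Space d} (hx : x ∈ frontier Ω) :
    AEStronglyMeasurable (fun v => f t x v * ⟪v, outwardNormal Ω x⟫)
      (volume.restrict {v : Space d | 0 < ⟪v, outwardNormal Ω x⟫}) := by
  have hopen : IsOpen {v : Space d | 0 < ⟪v, outwardNormal Ω x⟫} :=
    isOpen_lt continuous_const (by fun_prop)
  refine ContinuousOn.aestronglyMeasurable ?_ hopen.measurableSet
  refine ContinuousOn.mul ?_ (Continuous.continuousOn (by fun_prop))
  refine hf_cont.comp (f := fun v : Space d => (t, x, v))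
    (Continuous.continuousOn (by fun_prop)) fun v hv => ?_
  refine ⟨ht, ⟨frontier_subset_closure hx, mem_univ _⟩, fun h => ?_⟩
  have h2 := h.2
  rw [real_inner_comm] at h2
  exact (ne_of_gt hv) h2

/-- The final bound concerns a Bochner integral, whose default value `0` for non-integrable
functions must be excluded. -/
theorem IsMildSolution.integrableOn_outgoing (hf : IsMildSolution Ω Φ b Tw T f₀ f)
    (hTw : 0 < Tw) (hΩ : IsOpen Ω) (hconv : Convex ℝ Ω)
    (hf_cont : ContinuousOn (fun p : ℝ × Space d × Space d => f p.1 p.2.1 p.2.2)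
      (timeInterval T ×ˢ ((closure Ω ×ˢ univ) \ grazingSet Ω)))
    {x₀ : Space d} (hx₀ : x₀ ∈ Ω) {t : ℝ} (ht0 : 0 < t) (ht : t ∈ timeInterval T)
    {x : Space d} (hx : x ∈ frontier Ω) :
    IntegrableOn (fun v => f t x v * ⟪v, outwardNormal Ω x⟫)
      {v : Space d | 0 < ⟪v, outwardNormal Ω x⟫} := by
  refine ⟨aestronglyMeasurable_outgoing hf_cont ht hx, ?_⟩
  have hopen : IsOpen {v : Space d | 0 < ⟪v, outwardNormal Ω x⟫} :=
    isOpen_lt continuous_const (by fun_prop)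
  rw [hasFiniteIntegral_iff_ofReal]
  · exact hf.outgoingFlux_lt_top hTw hΩ hconv hx₀ ht0 ht hx
  · refine ae_restrict_of_forall_mem hopen.measurableSet fun v hv => ?_
    exact mul_nonneg (hf.nonneg t ht x (frontier_subset_closure hx) v) (le_of_lt hv)

/-- Straight trajectories from `closedBall x₀ (ρ / 2)` at time `τ / 2` to the boundary at time
`t` carry a positive density, if `f` is positive on a cylinder with large enough velocities. -/
theorem IsMildSolution.pos_on_frontier (hf : IsMildSolution Ω Φ b Tw T f₀ f)
    (hd : 2 ≤ d) (hΦ : IsPowerKernel Φ γ ∨ IsMollifiedKernel Φ γ) (hb : IsAngularKernel d b ν)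
    (hΩ : IsOpen Ω) (hconv : Convex ℝ Ω)
    (hf_cont : ContinuousOn (fun p : ℝ × Space d × Space d => f p.1 p.2.1 p.2.2)
      (timeInterval T ×ˢ ((closure Ω ×ˢ univ) \ grazingSet Ω)))
    {x₀ v₀ : Space d} {R τ ρ σ : ℝ} (hσ : 0 < σ) (hστ : σ < τ) (hball : Metric.ball x₀ ρ ⊆ Ω)
    (hpos : ∀ s ∈ Ioo 0 τ, ∀ x ∈ Metric.ball x₀ ρ, ∀ v ∈ Metric.ball v₀ R, 0 < f s x v)
    {t : ℝ} (ht : t ∈ timeInterval T) (hσt : σ < t) {x y : Space d} (hx : x ∈ frontier Ω)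
    (hy : y ∈ Metric.ball x₀ ρ) (hv : (t - σ)⁻¹ • (x - y) ∈ Metric.ball v₀ R)
    (hng : (x, (t - σ)⁻¹ • (x - y)) ∉ grazingSet Ω) :
    0 < f t x ((t - σ)⁻¹ • (x - y)) := by
  set v := (t - σ)⁻¹ • (x - y) with hvdef
  have htσ : 0 < t - σ := sub_pos.2 hσt
  have hXσ : charX σ t x v = y := by
    rw [charX, hvdef, smul_inv_smul₀ htσ.ne', sub_sub_cancel]
  have hcont : Continuous fun s : ℝ => charX s t x v := by
    unfold charX
    fun_prop
  have hev : ∀ᶠ s in 𝓝 σ, charX s t x v ∈ Metric.ball x₀ ρ := by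
    refine hcont.continuousAt.eventually (Metric.isOpen_ball.mem_nhds ?_)
    change charX σ t x v ∈ _
    rwa [hXσ]
  obtain ⟨δ, hδ, hδ'⟩ := Metric.eventually_nhds_iff.1 hev
  -- On `(σ, s₂]` the trajectory is still in the ball around `x₀` and the time is below `τ`, which
  -- makes the gain positive there.
  obtain ⟨s₂, hs₂, hs₂'⟩ := exists_between
    (show σ < min (σ + δ) (min τ t) from lt_min (by linarith) (lt_min hστ hσt))
  have h1 : s₂ < σ + δ := hs₂'.trans_le (min_le_left _ _)
  have h2 : s₂ < τ := hs₂'.trans_le ((min_le_right _ _).trans (min_le_left _ _))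
  have h3 : s₂ < t := hs₂'.trans_le ((min_le_right _ _).trans (min_le_right _ _))
  have hin : ∀ s, σ ≤ s → s < t → charX s t x v ∈ Ω := by
    intro s hs hst
    have := add_smul_sub_mem_of_mem_closure hΩ hconv (hball hy) (frontier_subset_closure hx)
      (r := (t - s) / (t - σ)) (div_pos (sub_pos.2 hst) htσ)
      ((div_le_one htσ).2 (by linarith))
    convert this using 1
    rw [charX, hvdef]
    module
  refine hf.pos_of_gain hΩ hf_cont hσ.le hs₂ h3 ht hin (frontier_subset_closure hx) hng
    fun s hs => ?_
  have hsx : charX s t x v ∈ Metric.ball x₀ ρ := by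
    refine hδ' ?_
    rw [Real.dist_eq, abs_of_pos (sub_pos.2 hs.1)]
    linarith [hs.2]
  have hs0 : 0 < s := hσ.trans hs.1
  refine gainQ_self_pos_of_ball hd hΦ hb (continuous_velocity_of_mem hΩ hf_cont
    (timeInterval_of_le ht hs0.le (hs.2.trans h3.le)) (hball hsx))
    (hpos s ⟨hs0, hs.2.trans_lt h2⟩ _ hsx) (Metric.ball_subset_ball ?_ hv)
  have hR : 0 < R := (dist_nonneg.trans_lt (Metric.mem_ball.1 hv))
  nlinarith [Real.one_lt_sqrt_two]

end BoundaryFlux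

/-! ### The uniform lower bound -/

theorem proposition3p4 {d : ℕ} (hd : 2 ≤ d)
    (Ω : Set (Space d)) (hΩ : IsC2Domain Ω) (hΩ_convex : Convex ℝ Ω)
    (hΩ_bdd : Bornology.IsBounded Ω)
    (Φ b : ℝ → ℝ) (γ ν : ℝ) (hγ : -(d : ℝ) < γ) (hγ_le : γ ≤ 1) (hν : ν < 0)
    (hΦ_meas : Measurable Φ) (hΦ : IsPowerKernel Φ γ ∨ IsMollifiedKernel Φ γ)
    (hb : IsAngularKernel d b ν)
    (Tw : ℝ) (hTw : 0 < Tw) (T : EReal) (hT : 0 < T)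
    (f₀ : Space d → Space d → ℝ)
    (hf₀_nonneg : ∀ x ∈ closure Ω, ∀ v, 0 ≤ f₀ x v)
    (hf₀_cont : ContinuousOn (fun p : Space d × Space d => f₀ p.1 p.2) (closure Ω ×ˢ univ))
    (f : ℝ → Space d → Space d → ℝ)
    (hf : IsMildSolution Ω Φ b Tw T f₀ f)
    (hf_cont : ContinuousOn (fun p : ℝ × Space d × Space d => f p.1 p.2.1 p.2.2)
      (timeInterval T ×ˢ ((closure Ω ×ˢ univ) \ grazingSet Ω)))
    (hf_init : ∀ x ∈ closure Ω, ∀ v, f 0 x v = f₀ x v)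
    (hmass : ∃ M : ℝ, 0 < M ∧ ∀ t ∈ timeInterval T, totalMass Ω (f t) = ENNReal.ofReal M)
    (henergy : energySup Ω T f < ∞)
    (hLp : IsPowerKernel Φ γ → γ < 0 →
      ∃ p : ℝ, (d : ℝ) / ((d : ℝ) + γ) < p ∧ lpSup Ω T p f < ∞) :
    ∀ Δ : ℝ, 0 < Δ → (Δ : EReal) < T →
      ∀ τ₀ ∈ Ioc 0 Δ, ∃ bw : ℝ, 0 < bw ∧
        ∀ t ∈ Icc τ₀ Δ, ∀ x ∈ frontier Ω,
          bw < ∫ v in {v : Space d | 0 < ⟪v, outwardNormal Ω x⟫},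
            f t x v * ⟪v, outwardNormal Ω x⟫ := by
  intro Δ hΔ hΔT τ₀ hτ₀
  obtain ⟨M, hM, hmass⟩ := hmass
  have hΔI : Δ ∈ timeInterval T := ⟨hΔ.le, hΔT⟩
  have h0 : (0 : ℝ) ∈ timeInterval T := timeInterval_of_le hΔI le_rfl hΔ.le
  obtain ⟨x₀, hx₀, v₀, hcyl⟩ := hf.exists_positiveOnCylinder hd hΦ hb hΩ.isOpen hf_cont h0
    (by rw [hmass 0 h0]; exact ENNReal.ofReal_pos.2 hM)
  obtain ⟨D, hD⟩ := Metric.isBounded_iff.1 hΩ_bdd.closure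
  -- With `σ < τ₀ / 2` and `D` bounding distances in `closure Ω`, the velocities `(x - y) / (t - σ)`
  -- have norm at most `2 * D / τ₀`, so they lie in this ball around `v₀`.
  obtain ⟨τ, ρ, hτ, hρ, -, hball, hpos⟩ := hcyl (‖v₀‖ + 2 * D / τ₀ + 1)
  have hτ₀0 : 0 < τ₀ := hτ₀.1
  obtain ⟨σ, hσ, hσ'⟩ := exists_between (show 0 < min τ (τ₀ / 2) from lt_min hτ (half_pos hτ₀0))
  have hστ : σ < τ := hσ'.trans_le (min_le_left _ _)
  have hστ₀ : σ < τ₀ / 2 := hσ'.trans_le (min_le_right _ _)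
  have htrans : ∀ x ∈ frontier Ω, ∀ y ∈ Metric.closedBall x₀ (ρ / 2),
      ρ / 4 ≤ ⟪x - y, outwardNormal Ω x⟫ := by
    intro x hx y hy
    refine hΩ.le_inner_outwardNormal hΩ_convex (by positivity) (fun z hz => hball ?_) hx
    rw [Metric.mem_closedBall] at hy hz
    rw [Metric.mem_ball]
    linarith [dist_triangle z y x₀]
  have hin : ∀ t ∈ Icc τ₀ Δ, ∀ x ∈ frontier Ω, ∀ y ∈ Metric.closedBall x₀ (ρ / 2),
      ρ / 4 / Δ ≤ ⟪(t - σ)⁻¹ • (x - y), outwardNormal Ω x⟫ := by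
    intro t ht x hx y hy
    have htσ : 0 < t - σ := by linarith [ht.1]
    have h1 := htrans x hx y hy
    rw [inner_smul_left, RCLike.conj_to_real, div_eq_inv_mul]
    have h2 : Δ⁻¹ ≤ (t - σ)⁻¹ := inv_anti₀ htσ (by linarith [ht.2])
    gcongr
  have hρΔ : 0 < ρ / 4 / Δ := by positivity
  have hng : ∀ t ∈ Icc τ₀ Δ, ∀ x ∈ frontier Ω, ∀ y ∈ Metric.closedBall x₀ (ρ / 2),
      (x, (t - σ)⁻¹ • (x - y)) ∉ grazingSet Ω := by
    intro t ht x hx y hy h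
    have h1 := h.2
    have h2 := hin t ht x hx y hy
    rw [real_inner_comm] at h1
    linarith
  have hsub : Metric.closedBall x₀ (ρ / 2) ⊆ Metric.ball x₀ ρ :=
    Metric.closedBall_subset_ball (by linarith)
  have htI : ∀ t ∈ Icc τ₀ Δ, t ∈ timeInterval T := fun t ht =>
    timeInterval_of_le hΔI (hτ₀0.le.trans ht.1) ht.2
  have hfr : IsCompact (frontier Ω) :=
    Metric.isCompact_of_isClosed_isBounded isClosed_frontier
      (hΩ_bdd.closure.subset frontier_subset_closure)
  have hcompact : IsCompact (Icc τ₀ Δ ×ˢ (frontier Ω ×ˢ Metric.closedBall x₀ (ρ / 2))) :=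
    isCompact_Icc.prod (hfr.prod (isCompact_closedBall _ _))
  have hcont : ContinuousOn
      (fun q : ℝ × Space d × Space d => f q.1 q.2.1 ((q.1 - σ)⁻¹ • (q.2.1 - q.2.2)))
      (Icc τ₀ Δ ×ˢ (frontier Ω ×ˢ Metric.closedBall x₀ (ρ / 2))) := by
    refine hf_cont.comp (f := fun q : ℝ × Space d × Space d =>
      (q.1, q.2.1, (q.1 - σ)⁻¹ • (q.2.1 - q.2.2))) ?_ fun q hq => ?_
    · have hne : ∀ q ∈ Icc τ₀ Δ ×ˢ (frontier Ω ×ˢ Metric.closedBall x₀ (ρ / 2)),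
          q.1 - σ ≠ 0 := fun q hq => by
        have := hq.1.1
        exact (show 0 < q.1 - σ by linarith).ne'
      fun_prop (disch := assumption)
    · exact ⟨htI _ hq.1, ⟨frontier_subset_closure hq.2.1, mem_univ _⟩,
        hng _ hq.1 _ hq.2.1 _ hq.2.2⟩
  obtain ⟨c, hc, hc'⟩ := hcompact.exists_forall_le' hcont (a := 0) (by
    rintro ⟨t, x, y⟩ ⟨ht, hx, hy⟩
    refine hf.pos_on_frontier hd hΦ hb hΩ.isOpen hΩ_convex hf_cont hσ hστ hball hpos (htI t ht)
      (by linarith [ht.1]) hx (hsub hy) ?_ (hng t ht x hx y hy)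
    have htσ : τ₀ / 2 ≤ t - σ := by linarith [ht.1]
    have h1 : ‖x - y‖ ≤ D := by
      rw [← dist_eq_norm]
      exact hD (frontier_subset_closure hx) (subset_closure (hball (hsub hy)))
    have h2 : ‖(t - σ)⁻¹ • (x - y)‖ ≤ 2 * D / τ₀ := by
      rw [norm_smul, norm_inv, Real.norm_of_nonneg (by linarith), ← div_eq_inv_mul]
      calc ‖x - y‖ / (t - σ) ≤ D / (τ₀ / 2) :=
            div_le_div₀ ((norm_nonneg _).trans h1) h1 (by positivity) htσ
        _ = 2 * D / τ₀ := by field_simp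
    rw [mem_ball_iff_norm]
    linarith [norm_sub_le ((t - σ)⁻¹ • (x - y)) v₀])
  set m := c * (ρ / 4 / Δ) * volume.real (Metric.ball (0 : Space d) (ρ / 2 / Δ)) with hm
  have hmpos : 0 < m := by
    have : 0 < volume.real (Metric.ball (0 : Space d) (ρ / 2 / Δ)) :=
      ENNReal.toReal_pos (Metric.measure_ball_pos _ _ (by positivity)).ne' measure_ball_lt_top.ne
    positivity
  refine ⟨m / 2, half_pos hmpos, fun t ht x hx => (half_lt_self hmpos).trans_le ?_⟩
  have htσ : 0 < t - σ := by linarith [ht.1]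
  -- As `t - σ ≤ Δ`, every velocity in this ball traces back from `x` at time `t` to a point within
  -- `ρ / 2` of `x₀` at time `σ`; the radius does not depend on `t` or `x`.
  set B := Metric.ball ((t - σ)⁻¹ • (x - x₀)) (ρ / 2 / Δ) with hB
  have hBy : ∀ v ∈ B, ∃ y ∈ Metric.closedBall x₀ (ρ / 2), v = (t - σ)⁻¹ • (x - y) := by
    intro v hv
    refine ⟨x - (t - σ) • v, ?_, ?_⟩
    · have h1 : x - (t - σ) • v - x₀ = -((t - σ) • (v - (t - σ)⁻¹ • (x - x₀))) := by
        rw [smul_sub, smul_inv_smul₀ htσ.ne']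
        abel
      have h2 := (mem_ball_iff_norm.1 hv).le
      rw [mem_closedBall_iff_norm, h1, norm_neg, norm_smul, Real.norm_of_nonneg htσ.le]
      calc (t - σ) * ‖v - (t - σ)⁻¹ • (x - x₀)‖ ≤ Δ * (ρ / 2 / Δ) := by
            gcongr
            linarith [ht.2]
        _ = ρ / 2 := by field_simp
    · rw [sub_sub_cancel, inv_smul_smul₀ htσ.ne']
  have hBin : ∀ v ∈ B, ρ / 4 / Δ ≤ ⟪v, outwardNormal Ω x⟫ := by
    intro v hv
    obtain ⟨y, hy, rfl⟩ := hBy v hv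
    exact hin t ht x hx y hy
  have hBS : B ⊆ {v : Space d | 0 < ⟪v, outwardNormal Ω x⟫} := fun v hv =>
    hρΔ.trans_le (hBin v hv)
  have hint := hf.integrableOn_outgoing hTw hΩ.isOpen hΩ_convex hf_cont hx₀
    (hτ₀0.trans_le ht.1) (htI t ht) hx
  have hBvol : volume.real B = volume.real (Metric.ball (0 : Space d) (ρ / 2 / Δ)) := by
    rw [hB, Measure.addHaar_real_ball_center]
  calc m = ∫ _ in B, c * (ρ / 4 / Δ) := by
        rw [setIntegral_const, hBvol, smul_eq_mul, hm]
        ring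
    _ ≤ ∫ v in B, f t x v * ⟪v, outwardNormal Ω x⟫ := by
        refine setIntegral_mono_on (integrableOn_const measure_ball_lt_top.ne)
          (hint.mono_set hBS) measurableSet_ball fun v hv => ?_
        obtain ⟨y, hy, hvy⟩ := hBy v hv
        have h1 := hc' (t, x, y) ⟨ht, hx, hy⟩
        simp only [← hvy] at h1
        exact mul_le_mul h1 (hBin v hv) hρΔ.le (hc.le.trans h1)
    _ ≤ ∫ v in {v : Space d | 0 < ⟪v, outwardNormal Ω x⟫}, f t x v * ⟪v, outwardNormal Ω x⟫ := by
        refine setIntegral_mono_set hint ?_ hBS.eventuallyLE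
        refine ae_restrict_of_forall_mem (measurableSet_lt measurable_const (by fun_prop))
          fun v hv => ?_
        exact mul_nonneg (hf.nonneg t (htI t ht) x (frontier_subset_closure hx) v) (le_of_lt hv)
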